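/- Let $n\in\mathbb N$, $\alpha\in(0,1)$ and $T>0$. For $k\in\mathbb{N}$ and a function $\varphi:[0,T]\to\mathbb R^k$ put $$(I^\alpha\varphi)(t)=\frac1{\Gamma(\alpha)}\int_0^t\frac{\varphi(\tau)}{(t-\tau)^{1-\alpha}}\,d\tau,\qquad (D^\alpha \varphi)(t)=\frac1{\Gamma(1-\alpha)}\frac{d}{dt}\int_0^t\frac{\varphi(\tau)}{(t-\tau)^{\alpha}}\,d\tau,\qquad t\in[0,T]$$ (the left-sided Riemann–Liouville fractional integral and derivative of order $\alpha$), and let $I^\alpha(L^\infty([0,T],\mathbb R^k))$ be the set of functions $x:[0,T]\to\mathbb R^k$ for which there is an essentially bounded measurable $\varphi:[0,T]\to\mathbb R^k$ with $x(t)=(I^\alpha\varphi)(t)$ for all $t\in[0,T]$. Let $V:\mathbb R^n\to\mathbb R$ be convex and differentiable with $V(0)=0$, and suppose that for every $r\ge 0$ there is $\lambda_V>0$ such that $\|\nabla V(u)-\nabla V(v)\|\le\lambda_V\|u-v\|$ for all $u,v\in\mathbb R^n$ with $\|u\|\le r$, $\|v\|\le r$. Let $x\in I^\alpha(L^\infty([0,T],\mathbb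 R^n))$ and $y(t)=V(x(t))$, $t\in[0,T]$. Then $y\in I^\alpha(L^\infty([0,T],\mathbb R))$, and for almost every $t\in[0,T]$ the values $(D^\alpha x)(t)$ and $(D^\alpha y)(t)$ are well defined and $$(D^\alpha y)(t)\le\langle\nabla V(x(t)),(D^\alpha x)(t)\rangle .$$ -/

import Mathlib

open MeasureTheory Set

noncomputable section

/-- The left-sided Riemann-Liouville fractional integral of order `α`:
`(I^α φ)(t) = (1 / Γ(α)) ∫₀ᵗ φ(τ) / (t - τ)^(1 - α) dτ`. -/
def rlIntegral {E : Type*} [NormedAddCommGroup E] [NormedSpace ℝ E]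
    (α : ℝ) (φ : ℝ → E) (t : ℝ) : E :=
  (1 / Real.Gamma α) • ∫ τ in (0 : ℝ)..t, (1 / (t - τ) ^ (1 - α)) • φ τ

/-- `x ∈ I^α(L^∞([0, T], E))`: on `[0, T]` the function `x` is the fractional integral of order `α`
of an essentially bounded measurable function. Values of `x` outside `[0, T]` are irrelevant. -/
def MemRLIntegralLinfty {E : Type*} [NormedAddCommGroup E] [NormedSpace ℝ E]
    (T α : ℝ) (x : ℝ → E) : Prop :=
  ∃ φ : ℝ → E, MemLp φ ⊤ (volume.restrict (Icc 0 T)) ∧ ∀ t ∈ Icc 0 T, x t = rlIntegral α φ t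

/-- The function `s ↦ ∫₀ˢ x(τ) / (s - τ)^α dτ`, whose derivative gives the Riemann-Liouville
derivative of order `α`. -/
def rlKernelIntegral {E : Type*} [NormedAddCommGroup E] [NormedSpace ℝ E]
    (α : ℝ) (x : ℝ → E) (s : ℝ) : E :=
  ∫ τ in (0 : ℝ)..s, (1 / (s - τ) ^ α) • x τ

/-- The Riemann-Liouville derivative of order `α` on `[0, T]`:
`(D^α x)(t) = (1 / Γ(1 - α)) (d/dt) ∫₀ᵗ x(τ) / (t - τ)^α dτ`, with the derivative taken within
`[0, T]` (one-sided at the end points). -/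
def rlDeriv {E : Type*} [NormedAddCommGroup E] [NormedSpace ℝ E]
    (T α : ℝ) (x : ℝ → E) (t : ℝ) : E :=
  (1 / Real.Gamma (1 - α)) • derivWithin (rlKernelIntegral α x) (Icc 0 T) t

/-- The value `(D^α x)(t)` is well defined: the integrals `∫₀ˢ x(τ) / (s - τ)^α dτ`, `s ∈ [0, T]`,
exist in the sense of Lebesgue, and the function of `s` that they define is differentiable
at `t`. -/
def RLDifferentiableAt {E : Type*} [NormedAddCommGroup E] [NormedSpace ℝ E]
    (T α : ℝ) (x : ℝ → E) (t : ℝ) : Prop :=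
  (∀ s ∈ Icc 0 T, IntervalIntegrable (fun τ => (1 / (s - τ) ^ α) • x τ) volume 0 s) ∧
    DifferentiableWithinAt ℝ (rlKernelIntegral α x) (Icc 0 T) t

end

/-!
Write `β = 1 - α`, so that `D^α` is the derivative of `I^β`. Fix `s` and expand `V` at `x(s)`:
`V(x(τ)) = V(x(s)) + DV(x(s))(x(τ) - x(s)) + g(τ)`. A function in `I^α(L^∞)` is `α`-Hölder, so the
Bregman remainder satisfies `|g(τ)| ≤ C|τ - s|^(2α)`. As `β + 2α = 1 + α > 1`, this vanishing at
`s` compensates the singular kernel of `I^β`, and the increment of `I^β g` from `s` to `t` is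
`O(t - s)`. Hence `I^β (V ∘ x)` is Lipschitz, i.e. the integral of some `ψ ∈ L^∞`, and inverting
the Abel integral equation `I^β (V ∘ x) = I^β (I^α ψ)` gives `V ∘ x = I^α ψ`.

If `V` is convex, then `g ≥ 0`. The kernel of `I^β` decreases in time, so the contribution of
`[0, s]` to the increment of `I^β g` from `s` to `t > s` is nonpositive, and that of `[s, t]` is
`O((t - s)^(1 + α))`. The constant `V(x(s)) - DV(x(s)) x(s)` in the expansion is nonpositive, by
convexity and `V(0) = 0`, so it too decreases `I^β (V ∘ x)`. Dividing the increments by `t - s` and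
letting `t` decrease to `s` yields `D^α (V ∘ x)(s) ≤ DV(x(s)) (D^α x)(s)`.
-/

open Filter Topology
open scoped NNReal

section PowerKernel

theorem intervalIntegrable_sub_rpow {r : ℝ} (hr : -1 < r) (t a b : ℝ) :
    IntervalIntegrable (fun τ => (t - τ) ^ r) volume a b := by
  simpa using
    (intervalIntegral.intervalIntegrable_rpow' (a := t - a) (b := t - b) hr).comp_sub_left t

theorem integral_sub_rpow {β : ℝ} (hβ : 0 < β) (t a b : ℝ) :
    ∫ τ in a..b, (t - τ) ^ (β - 1) = ((t - a) ^ β - (t - b) ^ β) / β := by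
  rw [intervalIntegral.integral_comp_sub_left (fun u => u ^ (β - 1)) t,
    integral_rpow (Or.inl (by linarith)), sub_add_cancel]

theorem integral_sub_rpow_mul_sub_rpow {α β : ℝ} (hα : 0 < α) (hβ : 0 < β) {a t : ℝ}
    (hat : a < t) :
    ∫ s in a..t, (t - s) ^ (α - 1) * (s - a) ^ (β - 1)
      = Real.Gamma α * Real.Gamma β / Real.Gamma (α + β) * (t - a) ^ (α + β - 1) := by
  have complex_integrand : ∀ x ∈ uIcc 0 (t - a),
      (x : ℂ) ^ ((β : ℂ) - 1) * (((t - a : ℝ) : ℂ) - x) ^ ((α : ℂ) - 1)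
        = ((x ^ (β - 1) * (t - a - x) ^ (α - 1) : ℝ) : ℂ) := by
    intro x hx
    rw [uIcc_of_le (sub_nonneg.2 hat.le)] at hx
    rw [Complex.ofReal_mul, Complex.ofReal_cpow hx.1, Complex.ofReal_cpow (sub_nonneg.2 hx.2)]
    push_cast
    rfl
  have scaled := Complex.betaIntegral_scaled β α (sub_pos.2 hat)
  rw [intervalIntegral.integral_congr complex_integrand, intervalIntegral.integral_ofReal,
    Complex.betaIntegral_eq_Gamma_mul_div _ _ (by simpa) (by simpa), ← Complex.ofReal_add,
    Complex.Gamma_ofReal, Complex.Gamma_ofReal, Complex.Gamma_ofReal, ← Complex.ofReal_one,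
    ← Complex.ofReal_sub, ← Complex.ofReal_cpow (sub_nonneg.2 hat.le)] at scaled
  have translated := intervalIntegral.integral_comp_sub_right
    (fun x => x ^ (β - 1) * (t - a - x) ^ (α - 1)) (a := a) (b := t) a
  rw [sub_self] at translated
  calc ∫ s in a..t, (t - s) ^ (α - 1) * (s - a) ^ (β - 1)
      = ∫ x in 0..t - a, x ^ (β - 1) * (t - a - x) ^ (α - 1) := by
        rw [← translated]
        simp only [sub_sub_sub_cancel_right, mul_comm]
    _ = (t - a) ^ (β + α - 1) * (Real.Gamma β * Real.Gamma α / Real.Gamma (β + α)) := by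
        exact_mod_cast scaled
    _ = Real.Gamma α * Real.Gamma β / Real.Gamma (α + β) * (t - a) ^ (α + β - 1) := by
        rw [add_comm β, mul_comm (Real.Gamma β), mul_comm]

theorem intervalIntegrable_sub_rpow_mul_sub_rpow {α β : ℝ} (hα : 0 < α) (hβ : 0 < β) {a t : ℝ}
    (hat : a < t) :
    IntervalIntegrable (fun s => (t - s) ^ (α - 1) * (s - a) ^ (β - 1)) volume a t := by
  apply intervalIntegral.intervalIntegrable_of_integral_ne_zero
  rw [integral_sub_rpow_mul_sub_rpow hα hβ hat]
  have := Real.Gamma_pos_of_pos hα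
  have := Real.Gamma_pos_of_pos hβ
  have := Real.Gamma_pos_of_pos (add_pos hα hβ)
  have := sub_pos.2 hat
  positivity

theorem sub_rpow_sub_sub_rpow_nonneg {β τ s t : ℝ} (hβ : β ≤ 1) (hτs : τ < s) (hst : s ≤ t) :
    0 ≤ (s - τ) ^ (β - 1) - (t - τ) ^ (β - 1) :=
  sub_nonneg.2 <| Real.rpow_le_rpow_of_nonpos (sub_pos.2 hτs) (by linarith) (by linarith)

theorem abs_rpow_sub_rpow_le {p a b : ℝ} (hp : |p| ≤ 1) (ha : 0 < a) (hab : a ≤ b) :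
    |b ^ p - a ^ p| ≤ (b - a) * a ^ (p - 1) := by
  obtain ⟨hp₁, hp₂⟩ := abs_le.1 hp
  have hb : 0 < b := ha.trans_le hab
  have rpow_a : a ^ p = a * a ^ (p - 1) := by
    rw [Real.rpow_sub_one ha.ne', mul_div_cancel₀ _ ha.ne']
  rw [abs_le, rpow_a]
  constructor
  · have increasing : a ^ (p + 1) ≤ b ^ (p + 1) := Real.rpow_le_rpow ha.le hab (by linarith)
    rw [Real.rpow_add_one ha.ne', Real.rpow_add_one hb.ne', rpow_a] at increasing
    have : 0 ≤ (b - a) ^ 2 * a ^ (p - 1) := by positivity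
    refine le_of_mul_le_mul_left ?_ hb
    nlinarith
  · have decreasing : b ^ (p - 1) ≤ a ^ (p - 1) :=
      Real.rpow_le_rpow_of_nonpos ha hab (by linarith)
    have rpow_b : b ^ p = b * b ^ (p - 1) := by
      rw [Real.rpow_sub_one hb.ne', mul_div_cancel₀ _ hb.ne']
    rw [rpow_b]
    nlinarith

theorem rpow_mul_abs_rpow_sub_rpow_le {p q s t : ℝ} (hp : |p| ≤ 1) (hq : q ≠ 0) (hs : 0 ≤ s)
    (hst : s ≤ t) : s ^ q * |t ^ p - s ^ p| ≤ s ^ (p + q - 1) * (t - s) := by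
  obtain rfl | hs := hs.eq_or_lt
  · rw [Real.zero_rpow hq, zero_mul]
    exact mul_nonneg (Real.rpow_nonneg le_rfl _) (sub_nonneg.2 hst)
  · calc s ^ q * |t ^ p - s ^ p| ≤ s ^ q * ((t - s) * s ^ (p - 1)) := by
          gcongr
          exact abs_rpow_sub_rpow_le hp hs hst
      _ = s ^ (p + q - 1) * (t - s) := by
          rw [show p + q - 1 = q + (p - 1) by ring, Real.rpow_add hs]
          ring

end PowerKernel

section FractionalIntegral

variable {E : Type*} [NormedAddCommGroup E] [NormedSpace ℝ E]

theorem rlIntegral_eq_smul_integral_rpow (α : ℝ) (φ : ℝ → E) {t : ℝ} (ht : 0 ≤ t) :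
    rlIntegral α φ t
      = (1 / Real.Gamma α) • ∫ τ in (0 : ℝ)..t, (t - τ) ^ (α - 1) • φ τ := by
  rw [rlIntegral]
  congr 1
  refine intervalIntegral.integral_congr fun τ hτ => ?_
  rw [uIcc_of_le ht] at hτ
  rw [one_div, ← Real.rpow_neg (sub_nonneg.2 hτ.2), neg_sub]

theorem rlKernelIntegral_eq_smul_rlIntegral {α : ℝ} (hα : α < 1) (x : ℝ → E) :
    rlKernelIntegral α x = Real.Gamma (1 - α) • rlIntegral (1 - α) x := by
  have := (Real.Gamma_pos_of_pos (sub_pos.2 hα)).ne'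
  ext s
  rw [Pi.smul_apply, rlIntegral, smul_smul, mul_one_div_cancel this, one_smul, sub_sub_cancel,
    rlKernelIntegral]

theorem rlIntegral_congr {α t : ℝ} {φ ψ : ℝ → E} (ht : 0 ≤ t) (h : EqOn φ ψ (Icc 0 t)) :
    rlIntegral α φ t = rlIntegral α ψ t := by
  rw [rlIntegral, rlIntegral]
  congr 1
  refine intervalIntegral.integral_congr fun τ hτ => ?_
  rw [uIcc_of_le ht] at hτ
  rw [h hτ]

theorem rlIntegral_apply_zero (α : ℝ) (φ : ℝ → E) : rlIntegral α φ 0 = 0 := by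
  rw [rlIntegral, intervalIntegral.integral_same, smul_zero]

theorem rlIntegral_one (φ : ℝ → E) (t : ℝ) : rlIntegral 1 φ t = ∫ τ in (0 : ℝ)..t, φ τ := by
  simp [rlIntegral]

theorem rlIntegral_const [CompleteSpace E] {α t : ℝ} (hα : 0 < α) (ht : 0 ≤ t) (c : E) :
    rlIntegral α (fun _ => c) t = (t ^ α / Real.Gamma (α + 1)) • c := by
  rw [rlIntegral_eq_smul_integral_rpow α _ ht, intervalIntegral.integral_smul_const,
    integral_sub_rpow hα, smul_smul, Real.Gamma_add_one hα.ne', sub_zero, sub_self,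
    Real.zero_rpow hα.ne', sub_zero]
  congr 1
  ring

end FractionalIntegral

section Semigroup

variable {E : Type*} [NormedAddCommGroup E] [NormedSpace ℝ E] {α β t τ s : ℝ}

/-- The kernel of `I^α I^β` before normalization: `(t - s)^(α - 1) (s - τ)^(β - 1)` on the triangle
`τ < s ≤ t` and `0` outside it, so that both orders of integration run over `(0, t]`. -/
noncomputable def compositionKernel (α β t s τ : ℝ) : ℝ :=
  (Ioc τ t).indicator (fun s => (t - s) ^ (α - 1) * (s - τ) ^ (β - 1)) s

theorem measurable_compositionKernel (α β t : ℝ) :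
    Measurable (Function.uncurry (compositionKernel α β t)) := by
  have : Function.uncurry (compositionKernel α β t)
      = {p : ℝ × ℝ | p.2 < p.1 ∧ p.1 ≤ t}.indicator
          (fun p => (t - p.1) ^ (α - 1) * (p.1 - p.2) ^ (β - 1)) := by
    ext p
    simp only [Function.uncurry, compositionKernel, indicator, mem_Ioc, mem_ofPred_eq]
  rw [this]
  exact Measurable.indicator (by fun_prop) <|
    (measurableSet_lt measurable_snd measurable_fst).inter
      (measurableSet_le measurable_fst measurable_const)

theorem compositionKernel_nonneg (α β t s τ : ℝ) : 0 ≤ compositionKernel α β t s τ :=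
  indicator_nonneg (fun _ hs => mul_nonneg (Real.rpow_nonneg (sub_nonneg.2 hs.2) _)
    (Real.rpow_nonneg (sub_nonneg.2 hs.1.le) _)) s

theorem integrable_compositionKernel (hα : 0 < α) (hβ : 0 < β) (hτ : τ ∈ Ioo 0 t) :
    Integrable (fun s => compositionKernel α β t s τ) (volume.restrict (Ioc 0 t)) := by
  have := (intervalIntegrable_iff_integrableOn_Ioc_of_le hτ.2.le).1
    (intervalIntegrable_sub_rpow_mul_sub_rpow hα hβ hτ.2)
  exact ((integrable_indicator_iff measurableSet_Ioc).2 this).integrableOn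

theorem integral_compositionKernel (hα : 0 < α) (hβ : 0 < β) (hτ : τ ∈ Ioo 0 t) :
    ∫ s in Ioc 0 t, compositionKernel α β t s τ
      = Real.Gamma α * Real.Gamma β / Real.Gamma (α + β) * (t - τ) ^ (α + β - 1) := by
  simp only [compositionKernel]
  rw [setIntegral_indicator measurableSet_Ioc, inter_eq_right.2 (Ioc_subset_Ioc_left hτ.1.le),
    ← intervalIntegral.integral_of_le hτ.2.le, integral_sub_rpow_mul_sub_rpow hα hβ hτ.2]

theorem setIntegral_compositionKernel_smul (hs : s ∈ Ioc 0 t) (φ : ℝ → E) :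
    ∫ τ in Ioc 0 t, compositionKernel α β t s τ • φ τ
      = (t - s) ^ (α - 1) • ∫ τ in (0 : ℝ)..s, (s - τ) ^ (β - 1) • φ τ := by
  have pointwise : ∀ τ, compositionKernel α β t s τ • φ τ
      = (Iio s).indicator (fun τ => (t - s) ^ (α - 1) • (s - τ) ^ (β - 1) • φ τ) τ := by
    intro τ
    by_cases hτ : τ < s
    · rw [compositionKernel, indicator_of_mem (show s ∈ Ioc τ t from ⟨hτ, hs.2⟩),
        indicator_of_mem (mem_Iio.2 hτ), mul_smul]
    · rw [compositionKernel, indicator_of_notMem (fun h => hτ h.1),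
        indicator_of_notMem (show τ ∉ Iio s from hτ), zero_smul]
  have interval : Ioc 0 t ∩ Iio s = Ioo 0 s := by
    ext τ
    exact ⟨fun h => ⟨h.1.1, h.2⟩, fun h => ⟨⟨h.1, h.2.le.trans hs.2⟩, h.2⟩⟩
  simp_rw [pointwise]
  rw [setIntegral_indicator measurableSet_Iio, interval, setIntegral_congr_set Ioo_ae_eq_Ioc,
    integral_smul, intervalIntegral.integral_of_le hs.1.le]

theorem ae_restrict_Ioc_mem_Ioo (a b : ℝ) : ∀ᵐ τ ∂volume.restrict (Ioc a b), τ ∈ Ioo a b := by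
  rw [← Measure.restrict_congr_set Ioo_ae_eq_Ioc]
  exact ae_restrict_mem measurableSet_Ioo

theorem aestronglyMeasurable_of_sub_rpow_smul {r : ℝ} {φ : ℝ → E}
    (hφ : AEStronglyMeasurable (fun τ => (t - τ) ^ r • φ τ) (volume.restrict (Ioc 0 t))) :
    AEStronglyMeasurable φ (volume.restrict (Ioc 0 t)) := by
  have inverse : AEStronglyMeasurable (fun τ => ((t - τ) ^ r)⁻¹) (volume.restrict (Ioc 0 t)) :=
    (by fun_prop : Measurable fun τ => ((t - τ) ^ r)⁻¹).aestronglyMeasurable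
  refine (inverse.smul hφ).congr ?_
  filter_upwards [ae_restrict_Ioc_mem_Ioo 0 t] with τ hτ
  exact inv_smul_smul₀ (Real.rpow_pos_of_pos (sub_pos.2 hτ.2) r).ne' _

theorem integrable_compositionKernel_smul (hα : 0 < α) (hβ : 0 < β) {φ : ℝ → E}
    (hφ : IntegrableOn (fun τ => (t - τ) ^ (α + β - 1) • φ τ) (Ioc 0 t)) :
    Integrable (Function.uncurry fun s τ => compositionKernel α β t s τ • φ τ)
      ((volume.restrict (Ioc 0 t)).prod (volume.restrict (Ioc 0 t))) := by
  have measurable : AEStronglyMeasurable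
      (Function.uncurry fun s τ => compositionKernel α β t s τ • φ τ)
      ((volume.restrict (Ioc 0 t)).prod (volume.restrict (Ioc 0 t))) :=
    (measurable_compositionKernel α β t).aestronglyMeasurable.smul
      (aestronglyMeasurable_of_sub_rpow_smul hφ.1).comp_snd
  rw [integrable_prod_iff' measurable]
  constructor
  · filter_upwards [ae_restrict_Ioc_mem_Ioo 0 t] with τ hτ
    exact (integrable_compositionKernel hα hβ hτ).smul_const (φ τ)
  · refine (hφ.norm.const_mul (Real.Gamma α * Real.Gamma β / Real.Gamma (α + β))).congr ?_
    filter_upwards [ae_restrict_Ioc_mem_Ioo 0 t] with τ hτ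
    simp only [Function.uncurry, norm_smul, Real.norm_of_nonneg (compositionKernel_nonneg ..),
      Real.norm_of_nonneg (Real.rpow_nonneg (sub_nonneg.2 hτ.2.le) _)]
    rw [integral_mul_const, integral_compositionKernel hα hβ hτ, mul_assoc]

theorem rlIntegral_rlIntegral [CompleteSpace E] (hα : 0 < α) (hβ : 0 < β) (ht : 0 ≤ t)
    {φ : ℝ → E}
    (hφ : IntervalIntegrable (fun τ => (t - τ) ^ (α + β - 1) • φ τ) volume 0 t) :
    rlIntegral α (rlIntegral β φ) t = rlIntegral (α + β) φ t := by
  have hΓα := (Real.Gamma_pos_of_pos hα).ne'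
  have hΓβ := (Real.Gamma_pos_of_pos hβ).ne'
  rw [intervalIntegrable_iff_integrableOn_Ioc_of_le ht] at hφ
  have inner_last : ∫ τ in Ioc 0 t, ∫ s in Ioc 0 t, compositionKernel α β t s τ • φ τ
      = (Real.Gamma α * Real.Gamma β / Real.Gamma (α + β)) •
          ∫ τ in Ioc 0 t, (t - τ) ^ (α + β - 1) • φ τ := by
    rw [← integral_smul]
    refine integral_congr_ae ?_
    filter_upwards [ae_restrict_Ioc_mem_Ioo 0 t] with τ hτ
    rw [integral_smul_const, integral_compositionKernel hα hβ hτ, mul_smul]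
  have inner_first : ∫ s in Ioc 0 t, ∫ τ in Ioc 0 t, compositionKernel α β t s τ • φ τ
      = Real.Gamma β • ∫ s in Ioc 0 t, (t - s) ^ (α - 1) • rlIntegral β φ s := by
    rw [← integral_smul]
    refine setIntegral_congr_fun measurableSet_Ioc fun s hs => ?_
    have normalize : Real.Gamma β • rlIntegral β φ s
        = ∫ τ in (0 : ℝ)..s, (s - τ) ^ (β - 1) • φ τ := by
      rw [rlIntegral_eq_smul_integral_rpow β φ hs.1.le, smul_smul, mul_one_div_cancel hΓβ, one_smul]
    simp only [setIntegral_compositionKernel_smul hs, smul_comm (Real.Gamma β), normalize]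
  have swap := integral_integral_swap (integrable_compositionKernel_smul hα hβ hφ)
  rw [inner_first, inner_last] at swap
  rw [rlIntegral_eq_smul_integral_rpow _ _ ht, rlIntegral_eq_smul_integral_rpow _ _ ht,
    intervalIntegral.integral_of_le ht, intervalIntegral.integral_of_le ht,
    (eq_inv_smul_iff₀ hΓβ).2 swap, smul_smul, smul_smul]
  congr 1
  field_simp

theorem rlIntegral_rlIntegral_one_sub [CompleteSpace E] (hα : α ∈ Ioo 0 1) (ht : 0 ≤ t)
    {φ : ℝ → E} (hφ : IntervalIntegrable φ volume 0 t) :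
    rlIntegral (1 - α) (rlIntegral α φ) t = ∫ τ in (0 : ℝ)..t, φ τ := by
  rw [rlIntegral_rlIntegral (sub_pos.2 hα.2) hα.1 ht (by simpa using hφ), sub_add_cancel,
    rlIntegral_one]

end Semigroup

section EssentiallyBounded

variable {E : Type*} [NormedAddCommGroup E] [NormedSpace ℝ E] {T β : ℝ} {φ : ℝ → E}

theorem intervalIntegrable_smul_of_memLp_top {a b c d : ℝ}
    (hφ : MemLp φ ⊤ (volume.restrict (Icc c d))) (ha : a ∈ Icc c d) (hb : b ∈ Icc c d)
    {k : ℝ → ℝ} (hk : IntervalIntegrable k volume a b) :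
    IntervalIntegrable (fun τ => k τ • φ τ) volume a b := by
  rw [intervalIntegrable_iff] at hk ⊢
  have subset := uIoc_subset_uIcc.trans (uIcc_subset_Icc ha hb)
  exact Integrable.smul_of_top_left hk (hφ.mono_measure (Measure.restrict_mono subset le_rfl))

theorem intervalIntegrable_of_memLp_top {a b c d : ℝ}
    (hφ : MemLp φ ⊤ (volume.restrict (Icc c d))) (ha : a ∈ Icc c d) (hb : b ∈ Icc c d) :
    IntervalIntegrable φ volume a b := by
  simpa using intervalIntegrable_smul_of_memLp_top hφ ha hb
    (intervalIntegrable_const (c := (1 : ℝ)))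

theorem memLp_top_of_continuousOn_Icc {F : Type*} [NormedAddCommGroup F] {φ : ℝ → F} {a b : ℝ}
    (hφ : ContinuousOn φ (Icc a b)) :
    MemLp φ ⊤ (volume.restrict (Icc a b)) := by
  obtain ⟨C, hC⟩ := isCompact_Icc.exists_bound_of_continuousOn hφ
  exact MemLp.of_bound (hφ.aestronglyMeasurable measurableSet_Icc) C
    (ae_restrict_of_forall_mem measurableSet_Icc hC)

theorem intervalIntegrable_sub_rpow_smul {a b c : ℝ}
    (hφ : MemLp φ ⊤ (volume.restrict (Icc 0 T))) (hβ : 0 < β) (ha : a ∈ Icc 0 T)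
    (hb : b ∈ Icc 0 T) :
    IntervalIntegrable (fun τ => (c - τ) ^ (β - 1) • φ τ) volume a b :=
  intervalIntegrable_smul_of_memLp_top hφ ha hb (intervalIntegrable_sub_rpow (by linarith) c a b)

theorem rlIntegral_add {ψ : ℝ → E} {t : ℝ} (hφ : MemLp φ ⊤ (volume.restrict (Icc 0 t)))
    (hψ : MemLp ψ ⊤ (volume.restrict (Icc 0 t))) (hβ : 0 < β) (ht : 0 ≤ t) :
    rlIntegral β (fun τ => φ τ + ψ τ) t = rlIntegral β φ t + rlIntegral β ψ t := by
  have zero_mem : (0 : ℝ) ∈ Icc 0 t := left_mem_Icc.2 ht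
  have t_mem : t ∈ Icc 0 t := right_mem_Icc.2 ht
  simp only [rlIntegral_eq_smul_integral_rpow _ _ ht, smul_add]
  rw [intervalIntegral.integral_add (intervalIntegrable_sub_rpow_smul hφ hβ zero_mem t_mem)
    (intervalIntegrable_sub_rpow_smul hψ hβ zero_mem t_mem), smul_add]

theorem rlIntegral_clm_comp [CompleteSpace E] {F : Type*} [NormedAddCommGroup F] [NormedSpace ℝ F]
    [CompleteSpace F] {t : ℝ} (L : E →L[ℝ] F) (hφ : MemLp φ ⊤ (volume.restrict (Icc 0 t)))
    (hβ : 0 < β) (ht : 0 ≤ t) :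
    rlIntegral β (fun τ => L (φ τ)) t = L (rlIntegral β φ t) := by
  simp only [rlIntegral_eq_smul_integral_rpow _ _ ht, map_smul]
  rw [← L.intervalIntegral_comp_comm (intervalIntegrable_sub_rpow_smul hφ hβ
    (left_mem_Icc.2 ht) (right_mem_Icc.2 ht))]
  simp only [map_smul]

theorem rlIntegral_sub_rlIntegral {s t : ℝ} (hφ : MemLp φ ⊤ (volume.restrict (Icc 0 t)))
    (hβ : 0 < β) (hs : 0 ≤ s) (hst : s ≤ t) :
    rlIntegral β φ t - rlIntegral β φ s
      = (1 / Real.Gamma β) • ((∫ τ in s..t, (t - τ) ^ (β - 1) • φ τ)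
          - ∫ τ in (0 : ℝ)..s, ((s - τ) ^ (β - 1) - (t - τ) ^ (β - 1)) • φ τ) := by
  have zero_mem : (0 : ℝ) ∈ Icc 0 t := left_mem_Icc.2 (hs.trans hst)
  have s_mem : s ∈ Icc 0 t := ⟨hs, hst⟩
  have t_mem : t ∈ Icc 0 t := right_mem_Icc.2 (hs.trans hst)
  have integrable_t := fun {a b : ℝ} (ha : a ∈ Icc 0 t) (hb : b ∈ Icc 0 t) =>
    intervalIntegrable_sub_rpow_smul (c := t) hφ hβ ha hb
  simp only [sub_smul]
  rw [rlIntegral_eq_smul_integral_rpow _ _ (hs.trans hst), rlIntegral_eq_smul_integral_rpow _ _ hs,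
    ← intervalIntegral.integral_add_adjacent_intervals (integrable_t zero_mem s_mem)
      (integrable_t s_mem t_mem),
    intervalIntegral.integral_sub (intervalIntegrable_sub_rpow_smul hφ hβ zero_mem s_mem)
      (integrable_t zero_mem s_mem), ← smul_sub]
  congr 1
  abel

theorem norm_integral_sub_rpow_smul_le {M s t : ℝ} (hβ : 0 < β) (hst : s ≤ t)
    (hφ : ∀ᵐ τ, τ ∈ Ioc s t → ‖φ τ‖ ≤ M) :
    ‖∫ τ in s..t, (t - τ) ^ (β - 1) • φ τ‖ ≤ M * (t - s) ^ β / β := by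
  have integral_bound : ∫ τ in s..t, (t - τ) ^ (β - 1) * M = M * (t - s) ^ β / β := by
    rw [intervalIntegral.integral_mul_const, integral_sub_rpow hβ, sub_self,
      Real.zero_rpow hβ.ne', sub_zero]
    ring
  rw [← integral_bound]
  refine intervalIntegral.norm_integral_le_of_norm_le hst ?_
    ((intervalIntegrable_sub_rpow (by linarith) t s t).mul_const M)
  filter_upwards [hφ] with τ hφτ hτ
  have := Real.rpow_nonneg (sub_nonneg.2 hτ.2) (β - 1)
  rw [norm_smul, Real.norm_of_nonneg this]
  exact mul_le_mul_of_nonneg_left (hφτ hτ) this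

theorem norm_integral_sub_rpow_sub_smul_le {M s t : ℝ} (hβ : β ∈ Ioc 0 1) (hs : 0 ≤ s)
    (hst : s ≤ t) (hM : 0 ≤ M) (hφ : ∀ᵐ τ, τ ∈ Ioc 0 s → ‖φ τ‖ ≤ M) :
    ‖∫ τ in (0 : ℝ)..s, ((s - τ) ^ (β - 1) - (t - τ) ^ (β - 1)) • φ τ‖
      ≤ M * (t - s) ^ β / β := by
  have integrable := fun c : ℝ =>
    intervalIntegrable_sub_rpow (r := β - 1) (by linarith [hβ.1]) c 0 s
  have integral_bound : ∫ τ in (0 : ℝ)..s, ((s - τ) ^ (β - 1) - (t - τ) ^ (β - 1)) * M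
      ≤ M * (t - s) ^ β / β := by
    have monotone : s ^ β ≤ t ^ β := Real.rpow_le_rpow hs hst hβ.1.le
    rw [intervalIntegral.integral_mul_const,
      intervalIntegral.integral_sub (integrable s) (integrable t), integral_sub_rpow hβ.1,
      integral_sub_rpow hβ.1, sub_self, sub_zero, sub_zero, Real.zero_rpow hβ.1.ne', ← sub_div,
      mul_comm, ← mul_div_assoc]
    have := hβ.1
    gcongr
    linarith
  refine le_trans (intervalIntegral.norm_integral_le_of_norm_le hs ?_
    (((integrable s).sub (integrable t)).mul_const M)) integral_bound
  filter_upwards [hφ, Measure.ae_ne volume s] with τ hφτ hne hτ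
  have := sub_rpow_sub_sub_rpow_nonneg hβ.2 (lt_of_le_of_ne hτ.2 hne) hst
  rw [norm_smul, Real.norm_of_nonneg this]
  exact mul_le_mul_of_nonneg_left (hφτ hτ) this

theorem norm_rlIntegral_sub_rlIntegral_le {M s t : ℝ}
    (hφ : MemLp φ ⊤ (volume.restrict (Icc 0 t))) (hβ : β ∈ Ioc 0 1) (hs : 0 ≤ s) (hst : s ≤ t)
    (hM : 0 ≤ M) (hφM : ∀ᵐ τ, τ ∈ Icc 0 t → ‖φ τ‖ ≤ M) :
    ‖rlIntegral β φ t - rlIntegral β φ s‖ ≤ 2 * M / Real.Gamma (β + 1) * (t - s) ^ β := by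
  have near := norm_integral_sub_rpow_smul_le (M := M) (φ := φ) hβ.1 hst <| by
    filter_upwards [hφM] with τ hφτ hτ using hφτ ⟨hs.trans hτ.1.le, hτ.2⟩
  have far := norm_integral_sub_rpow_sub_smul_le (M := M) (φ := φ) hβ hs hst hM <| by
    filter_upwards [hφM] with τ hφτ hτ using hφτ ⟨hτ.1.le, hτ.2.trans hst⟩
  have hΓ := Real.Gamma_pos_of_pos hβ.1
  have := hβ.1.ne'
  rw [rlIntegral_sub_rlIntegral hφ hβ.1 hs hst, norm_smul, Real.norm_of_nonneg (by positivity)]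
  calc 1 / Real.Gamma β * ‖_‖
      ≤ 1 / Real.Gamma β * (M * (t - s) ^ β / β + M * (t - s) ^ β / β) := by
        gcongr
        exact (norm_sub_le _ _).trans (add_le_add near far)
    _ = 2 * M / Real.Gamma (β + 1) * (t - s) ^ β := by
        rw [Real.Gamma_add_one hβ.1.ne']
        field_simp
        ring

theorem memLp_top_Icc_of_le {F : Type*} [NormedAddCommGroup F] {φ : ℝ → F} {a b c : ℝ}
    (hφ : MemLp φ ⊤ (volume.restrict (Icc a c))) (hbc : b ≤ c) :
    MemLp φ ⊤ (volume.restrict (Icc a b)) :=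
  hφ.mono_measure (Measure.restrict_mono (Icc_subset_Icc_right hbc) le_rfl)

theorem holderOnWith_of_dist_le_of_le {X : Type*} [PseudoMetricSpace X] {f : ℝ → X} {C r : ℝ≥0}
    {S : Set ℝ} (h : ∀ s ∈ S, ∀ t ∈ S, s ≤ t → dist (f t) (f s) ≤ C * (t - s) ^ (r : ℝ)) :
    HolderOnWith C r f S := by
  intro s hs t ht
  wlog hst : s ≤ t generalizing s t
  · rw [edist_comm, edist_comm s]
    exact this t ht s hs (le_of_not_ge hst)
  rw [edist_comm, edist_dist, edist_comm, edist_dist, Real.dist_eq,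
    abs_of_nonneg (sub_nonneg.2 hst),
    ENNReal.ofReal_rpow_of_nonneg (sub_nonneg.2 hst) r.coe_nonneg, ← ENNReal.ofReal_coe_nnreal,
    ← ENNReal.ofReal_mul C.coe_nonneg]
  exact ENNReal.ofReal_le_ofReal (h s hs t ht hst)

theorem exists_holderOnWith_rlIntegral (hφ : MemLp φ ⊤ (volume.restrict (Icc 0 T)))
    (hβ : β ∈ Ioc 0 1) : ∃ C, HolderOnWith C β.toNNReal (rlIntegral β φ) (Icc 0 T) := by
  set M := lpNorm φ ⊤ (volume.restrict (Icc 0 T))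
  have hΓ := Real.Gamma_pos_of_pos (by linarith [hβ.1] : 0 < β + 1)
  have hM : 0 ≤ M := lpNorm_nonneg
  refine ⟨⟨2 * M / Real.Gamma (β + 1), by positivity⟩,
    holderOnWith_of_dist_le_of_le fun s hs t ht hst => ?_⟩
  rw [dist_eq_norm, Real.coe_toNNReal _ hβ.1.le]
  refine norm_rlIntegral_sub_rlIntegral_le (memLp_top_Icc_of_le hφ ht.2) hβ hs.1 hst hM ?_
  filter_upwards [(ae_restrict_iff' measurableSet_Icc).1 (ae_le_lpNorm_exponent_top hφ)]
    with τ hτ hτt using hτ ⟨hτt.1, hτt.2.trans ht.2⟩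

theorem continuousOn_rlIntegral (hφ : MemLp φ ⊤ (volume.restrict (Icc 0 T)))
    (hβ : β ∈ Ioc 0 1) : ContinuousOn (rlIntegral β φ) (Icc 0 T) :=
  let ⟨_, holder⟩ := exists_holderOnWith_rlIntegral hφ hβ
  holder.continuousOn (Real.toNNReal_pos.2 hβ.1)

theorem exists_lipschitzOnWith_integral (hφ : MemLp φ ⊤ (volume.restrict (Icc 0 T))) :
    ∃ C, LipschitzOnWith C (fun t => ∫ τ in (0 : ℝ)..t, φ τ) (Icc 0 T) := by
  have ⟨C, holder⟩ := exists_holderOnWith_rlIntegral hφ (right_mem_Ioc.2 one_pos)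
  rw [Real.toNNReal_one, holderOnWith_one, funext (rlIntegral_one φ)] at holder
  exact ⟨C, holder⟩

theorem norm_integral_sub_rpow_sub_smul_le_of_norm_le_rpow {C γ s t : ℝ} (hβ : β ∈ Icc 0 1)
    (hγ : 1 < β + γ) (hs : 0 ≤ s) (hst : s ≤ t) (hφ : ∀ τ ∈ Icc 0 s, ‖φ τ‖ ≤ C * (s - τ) ^ γ) :
    ‖∫ τ in (0 : ℝ)..s, ((s - τ) ^ (β - 1) - (t - τ) ^ (β - 1)) • φ τ‖
      ≤ C * s ^ (β + γ - 1) / (β + γ - 1) * (t - s) := by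
  have integral_bound : ∫ τ in (0 : ℝ)..s, C * (t - s) * (s - τ) ^ (β + γ - 1 - 1)
      = C * s ^ (β + γ - 1) / (β + γ - 1) * (t - s) := by
    rw [intervalIntegral.integral_const_mul, integral_sub_rpow (by linarith), sub_self, sub_zero,
      Real.zero_rpow (by linarith), sub_zero]
    ring
  rw [← integral_bound]
  refine intervalIntegral.norm_integral_le_of_norm_le hs ?_
    ((intervalIntegrable_sub_rpow (by linarith) s 0 s).const_mul _)
  filter_upwards [Measure.ae_ne volume s] with τ hne hτ
  have hτs : 0 < s - τ := sub_pos.2 (lt_of_le_of_ne hτ.2 hne)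
  have kernel_bound : ‖(s - τ) ^ (β - 1) - (t - τ) ^ (β - 1)‖
      ≤ (t - s) * (s - τ) ^ (β - 1 - 1) := by
    have := abs_rpow_sub_rpow_le (p := β - 1) (b := t - τ)
      (abs_le.2 ⟨by linarith [hβ.1], by linarith [hβ.2]⟩) hτs (by linarith)
    rwa [sub_sub_sub_cancel_right, abs_sub_comm] at this
  calc ‖((s - τ) ^ (β - 1) - (t - τ) ^ (β - 1)) • φ τ‖
      ≤ (t - s) * (s - τ) ^ (β - 1 - 1) * (C * (s - τ) ^ γ) := by
        rw [norm_smul]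
        exact mul_le_mul kernel_bound (hφ τ ⟨hτ.1.le, hτ.2⟩) (norm_nonneg _)
          ((norm_nonneg _).trans kernel_bound)
    _ = C * (t - s) * ((s - τ) ^ (β - 1 - 1) * (s - τ) ^ γ) := by ring
    _ = C * (t - s) * (s - τ) ^ (β + γ - 1 - 1) := by
        rw [← Real.rpow_add hτs]
        ring_nf

theorem norm_integral_sub_rpow_smul_le_of_norm_le_rpow {C γ s t : ℝ} (hβ : 0 < β) (hγ : 0 ≤ γ)
    (hC : 0 ≤ C) (hst : s ≤ t) (hφ : ∀ τ ∈ Icc s t, ‖φ τ‖ ≤ C * (τ - s) ^ γ) :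
    ‖∫ τ in s..t, (t - τ) ^ (β - 1) • φ τ‖ ≤ C / β * (t - s) ^ (β + γ) := by
  have bound : ∀ τ ∈ Icc s t, ‖φ τ‖ ≤ C * (t - s) ^ γ := fun τ hτ => (hφ τ hτ).trans <|
    mul_le_mul_of_nonneg_left
      (Real.rpow_le_rpow (sub_nonneg.2 hτ.1) (sub_le_sub_right hτ.2 s) hγ) hC
  refine (norm_integral_sub_rpow_smul_le hβ hst
    (.of_forall fun τ hτ => bound τ (Ioc_subset_Icc_self hτ))).trans_eq ?_
  rw [add_comm, Real.rpow_add_of_nonneg (sub_nonneg.2 hst) hγ hβ.le]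
  ring

theorem norm_rlIntegral_sub_rlIntegral_le_of_norm_le_rpow {C γ s t : ℝ}
    (hφ : MemLp φ ⊤ (volume.restrict (Icc 0 t))) (hβ : β ∈ Ioc 0 1) (hγ : 1 < β + γ)
    (hC : 0 ≤ C) (hs : 0 ≤ s) (hst : s ≤ t) (hφC : ∀ τ ∈ Icc 0 t, ‖φ τ‖ ≤ C * |τ - s| ^ γ) :
    ‖rlIntegral β φ t - rlIntegral β φ s‖
      ≤ C / Real.Gamma β * (1 / β + 1 / (β + γ - 1)) * t ^ (β + γ - 1) * (t - s) := by
  have hβ₀ := hβ.1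
  have hγ₀ : 0 < β + γ - 1 := by linarith
  have := Real.Gamma_pos_of_pos hβ₀
  have : 0 ≤ t := hs.trans hst
  have near : ‖∫ τ in s..t, (t - τ) ^ (β - 1) • φ τ‖
      ≤ C * t ^ (β + γ - 1) / β * (t - s) := by
    refine (norm_integral_sub_rpow_smul_le_of_norm_le_rpow (γ := γ) hβ₀ (by linarith [hβ.2]) hC hst
      fun τ hτ => ?_).trans ?_
    · simpa only [abs_of_nonneg (sub_nonneg.2 hτ.1)] using hφC τ ⟨hs.trans hτ.1, hτ.2⟩
    · rw [show β + γ = β + γ - 1 + 1 by ring,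
        Real.rpow_add_of_nonneg (sub_nonneg.2 hst) hγ₀.le zero_le_one, Real.rpow_one, ← mul_assoc,
        add_sub_cancel_right, div_mul_eq_mul_div]
      have : (0 : ℝ) ≤ t - s := sub_nonneg.2 hst
      gcongr
      linarith
  have far : ‖∫ τ in (0 : ℝ)..s, ((s - τ) ^ (β - 1) - (t - τ) ^ (β - 1)) • φ τ‖
      ≤ C * t ^ (β + γ - 1) / (β + γ - 1) * (t - s) := by
    refine (norm_integral_sub_rpow_sub_smul_le_of_norm_le_rpow (C := C) (Ioc_subset_Icc_self hβ)
      hγ hs hst fun τ hτ => ?_).trans ?_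
    · simpa only [abs_sub_comm τ, abs_of_nonneg (sub_nonneg.2 hτ.2)]
        using hφC τ ⟨hτ.1, hτ.2.trans hst⟩
    · have : (0 : ℝ) ≤ t - s := sub_nonneg.2 hst
      gcongr
  rw [rlIntegral_sub_rlIntegral hφ hβ₀ hs hst, norm_smul, Real.norm_of_nonneg (by positivity)]
  calc 1 / Real.Gamma β * ‖_‖
      ≤ 1 / Real.Gamma β * (C * t ^ (β + γ - 1) / β * (t - s)
          + C * t ^ (β + γ - 1) / (β + γ - 1) * (t - s)) := by
        gcongr
        exact (norm_sub_le _ _).trans (add_le_add near far)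
    _ = C / Real.Gamma β * (1 / β + 1 / (β + γ - 1)) * t ^ (β + γ - 1) * (t - s) := by ring

theorem rlIntegral_sub_rlIntegral_le_of_nonneg {g : ℝ → ℝ} {C γ s t : ℝ}
    (hg : MemLp g ⊤ (volume.restrict (Icc 0 t))) (hβ : β ∈ Ioc 0 1) (hγ : 0 ≤ γ) (hC : 0 ≤ C)
    (hs : 0 ≤ s) (hst : s ≤ t) (hg₀ : ∀ τ ∈ Icc 0 s, 0 ≤ g τ)
    (hgC : ∀ τ ∈ Icc s t, |g τ| ≤ C * (τ - s) ^ γ) :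
    rlIntegral β g t - rlIntegral β g s ≤ C / Real.Gamma (β + 1) * (t - s) ^ (β + γ) := by
  have hΓ := Real.Gamma_pos_of_pos hβ.1
  have near := (Real.le_norm_self _).trans
    (norm_integral_sub_rpow_smul_le_of_norm_le_rpow hβ.1 hγ hC hst hgC)
  have far : 0 ≤ ∫ τ in (0 : ℝ)..s, ((s - τ) ^ (β - 1) - (t - τ) ^ (β - 1)) • g τ := by
    refine intervalIntegral.integral_nonneg_of_ae_restrict hs ?_
    filter_upwards [ae_restrict_mem measurableSet_Icc, Measure.ae_ne _ s] with τ hτ hne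
    exact mul_nonneg (sub_rpow_sub_sub_rpow_nonneg hβ.2 (lt_of_le_of_ne hτ.2 hne) hst) (hg₀ τ hτ)
  rw [rlIntegral_sub_rlIntegral hg hβ.1 hs hst, smul_eq_mul]
  calc 1 / Real.Gamma β * _ ≤ 1 / Real.Gamma β * (C / β * (t - s) ^ (β + γ)) := by
        gcongr
        linarith
    _ = C / Real.Gamma (β + 1) * (t - s) ^ (β + γ) := by
        have := hβ.1.ne'
        rw [Real.Gamma_add_one hβ.1.ne']
        field_simp

end EssentiallyBounded

section Inversion

variable {E : Type*} [NormedAddCommGroup E] [NormedSpace ℝ E] [CompleteSpace E] {α T : ℝ}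

theorem ae_eq_of_integral_eq {φ ψ : ℝ → E} (hT : 0 < T) (hφ : IntervalIntegrable φ volume 0 T)
    (hψ : IntervalIntegrable ψ volume 0 T)
    (h : ∀ t ∈ Icc 0 T, ∫ τ in (0 : ℝ)..t, φ τ = ∫ τ in (0 : ℝ)..t, ψ τ) :
    φ =ᵐ[volume.restrict (Icc 0 T)] ψ := by
  rw [EventuallyEq, ae_restrict_iff' measurableSet_Icc]
  filter_upwards [hφ.ae_hasDerivAt_integral, hψ.ae_hasDerivAt_integral] with t hφt hψt ht
  rw [← uIcc_of_le hT.le] at ht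
  have derivφ := (hφt ht 0 left_mem_uIcc).hasDerivWithinAt (s := Icc 0 T)
  have derivψ := (hψt ht 0 left_mem_uIcc).hasDerivWithinAt (s := Icc 0 T)
  rw [uIcc_of_le hT.le] at ht
  exact (uniqueDiffOn_Icc hT t ht).eq_deriv _ derivφ (derivψ.congr h (h t ht))

theorem ae_eq_of_rlIntegral_eq {φ ψ : ℝ → E} (hα : α ∈ Ioo 0 1) (hT : 0 < T)
    (hφ : MemLp φ ⊤ (volume.restrict (Icc 0 T))) (hψ : MemLp ψ ⊤ (volume.restrict (Icc 0 T)))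
    (h : EqOn (rlIntegral α φ) (rlIntegral α ψ) (Icc 0 T)) :
    φ =ᵐ[volume.restrict (Icc 0 T)] ψ := by
  have integrable := fun {χ : ℝ → E} (hχ : MemLp χ ⊤ (volume.restrict (Icc 0 T))) {t : ℝ}
    (ht : t ∈ Icc 0 T) => intervalIntegrable_of_memLp_top hχ (left_mem_Icc.2 hT.le) ht
  have hT' : T ∈ Icc 0 T := right_mem_Icc.2 hT.le
  refine ae_eq_of_integral_eq hT (integrable hφ hT') (integrable hψ hT') fun t ht => ?_
  rw [← rlIntegral_rlIntegral_one_sub hα ht.1 (integrable hφ ht),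
    ← rlIntegral_rlIntegral_one_sub hα ht.1 (integrable hψ ht)]
  exact rlIntegral_congr ht.1 (h.mono (Icc_subset_Icc_right ht.2))

theorem exists_memLp_top_integral_eq_of_lipschitzOnWith {f : ℝ → ℝ} {K : ℝ≥0}
    (hf : LipschitzOnWith K f (Icc 0 T)) (hf₀ : f 0 = 0) :
    ∃ ψ : ℝ → ℝ, MemLp ψ ⊤ (volume.restrict (Icc 0 T)) ∧
      ∀ t ∈ Icc 0 T, f t = ∫ τ in (0 : ℝ)..t, ψ τ := by
  refine ⟨deriv f, MemLp.of_bound (measurable_deriv f).aestronglyMeasurable K ?_, fun t ht => ?_⟩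
  · rw [← restrict_Ioo_eq_restrict_Icc]
    refine ae_restrict_of_forall_mem measurableSet_Ioo fun t ht => ?_
    exact norm_deriv_le_of_lipschitzOn (Icc_mem_nhds ht.1 ht.2) hf
  · have lipschitz : LipschitzOnWith K f (uIcc 0 t) :=
      hf.mono (uIcc_subset_Icc ⟨le_rfl, ht.1.trans ht.2⟩ ht)
    rw [lipschitz.absolutelyContinuousOnInterval.integral_deriv_eq_sub, hf₀, sub_zero]

theorem memRLIntegralLinfty_of_lipschitzOnWith {y : ℝ → ℝ} {K : ℝ≥0} (hα : α ∈ Ioo 0 1)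
    (hT : 0 < T) (hy : ContinuousOn y (Icc 0 T))
    (hK : LipschitzOnWith K (rlIntegral (1 - α) y) (Icc 0 T)) : MemRLIntegralLinfty T α y := by
  obtain ⟨ψ, hψ, integral_eq⟩ :=
    exists_memLp_top_integral_eq_of_lipschitzOnWith hK (rlIntegral_apply_zero _ _)
  have continuousOn_ψ : ContinuousOn (rlIntegral α ψ) (Icc 0 T) :=
    continuousOn_rlIntegral hψ (Ioo_subset_Ioc_self hα)
  have ae_eq : y =ᵐ[volume.restrict (Icc 0 T)] rlIntegral α ψ := by
    refine ae_eq_of_rlIntegral_eq (α := 1 - α) ⟨by linarith [hα.2], by linarith [hα.1]⟩ hT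
      (memLp_top_of_continuousOn_Icc hy) (memLp_top_of_continuousOn_Icc continuousOn_ψ)
      fun t ht => ?_
    rw [integral_eq t ht, rlIntegral_rlIntegral_one_sub hα ht.1
      (intervalIntegrable_of_memLp_top hψ (left_mem_Icc.2 hT.le) ht)]
  exact ⟨ψ, hψ, Measure.eqOn_Icc_of_ae_eq volume hT.ne ae_eq hy continuousOn_ψ⟩

end Inversion

section MemRLIntegralLinfty

variable {E : Type*} [NormedAddCommGroup E] [NormedSpace ℝ E] {α T : ℝ} {x : ℝ → E}

theorem intervalIntegrable_one_div_sub_rpow_smul_of_continuousOn {s : ℝ} (hα : α < 1)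
    (hs : 0 ≤ s) (hx : ContinuousOn x (Icc 0 s)) :
    IntervalIntegrable (fun τ => (1 / (s - τ) ^ α) • x τ) volume 0 s := by
  have integrable : IntervalIntegrable (fun τ => (s - τ) ^ (1 - α - 1) • x τ) volume 0 s :=
    intervalIntegrable_sub_rpow_smul (memLp_top_of_continuousOn_Icc hx) (sub_pos.2 hα)
      (left_mem_Icc.2 hs) (right_mem_Icc.2 hs)
  refine integrable.congr fun τ hτ => ?_
  rw [uIoc_of_le hs] at hτ
  rw [one_div, ← Real.rpow_neg (sub_nonneg.2 hτ.2)]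
  ring_nf

theorem RLDifferentiableAt.hasDerivWithinAt {t : ℝ} (hα : α < 1)
    (h : RLDifferentiableAt T α x t) :
    HasDerivWithinAt (rlIntegral (1 - α) x) (rlDeriv T α x t) (Icc 0 T) t := by
  have hΓ := (Real.Gamma_pos_of_pos (sub_pos.2 hα)).ne'
  have eq_smul : rlIntegral (1 - α) x = (1 / Real.Gamma (1 - α)) • rlKernelIntegral α x := by
    rw [rlKernelIntegral_eq_smul_rlIntegral hα, smul_smul, one_div_mul_cancel hΓ, one_smul]
  rw [eq_smul]
  exact h.2.hasDerivWithinAt.const_smul _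

namespace MemRLIntegralLinfty

theorem exists_holderOnWith (hα : α ∈ Ioo 0 1) (hx : MemRLIntegralLinfty T α x) :
    ∃ C, HolderOnWith C α.toNNReal x (Icc 0 T) := by
  obtain ⟨φ, hφ, x_eq⟩ := hx
  obtain ⟨C, hC⟩ := exists_holderOnWith_rlIntegral hφ (Ioo_subset_Ioc_self hα)
  refine ⟨C, fun s hs t ht => ?_⟩
  rw [x_eq s hs, x_eq t ht]
  exact hC s hs t ht

theorem continuousOn (hα : α ∈ Ioo 0 1) (hx : MemRLIntegralLinfty T α x) :
    ContinuousOn x (Icc 0 T) := by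
  obtain ⟨C, hC⟩ := hx.exists_holderOnWith hα
  exact hC.continuousOn (Real.toNNReal_pos.2 hα.1)

theorem apply_zero (hT : 0 ≤ T) (hx : MemRLIntegralLinfty T α x) : x 0 = 0 := by
  obtain ⟨φ, -, x_eq⟩ := hx
  rw [x_eq 0 (left_mem_Icc.2 hT), rlIntegral_apply_zero]

theorem exists_rlIntegral_one_sub_eq_integral [CompleteSpace E] (hα : α ∈ Ioo 0 1)
    (hx : MemRLIntegralLinfty T α x) :
    ∃ φ : ℝ → E, MemLp φ ⊤ (volume.restrict (Icc 0 T)) ∧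
      EqOn (rlIntegral (1 - α) x) (fun t => ∫ τ in (0 : ℝ)..t, φ τ) (Icc 0 T) := by
  obtain ⟨φ, hφ, x_eq⟩ := hx
  refine ⟨φ, hφ, fun t ht => ?_⟩
  have x_eqOn : EqOn x (rlIntegral α φ) (Icc 0 t) := fun τ hτ => x_eq τ ⟨hτ.1, hτ.2.trans ht.2⟩
  rw [rlIntegral_congr ht.1 x_eqOn, rlIntegral_rlIntegral_one_sub hα ht.1
    (intervalIntegrable_of_memLp_top hφ (left_mem_Icc.2 (ht.1.trans ht.2)) ht)]

theorem exists_lipschitzOnWith_rlIntegral [CompleteSpace E] (hα : α ∈ Ioo 0 1)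
    (hx : MemRLIntegralLinfty T α x) :
    ∃ C, LipschitzOnWith C (rlIntegral (1 - α) x) (Icc 0 T) := by
  obtain ⟨φ, hφ, integral_eq⟩ := hx.exists_rlIntegral_one_sub_eq_integral hα
  obtain ⟨C, hC⟩ := exists_lipschitzOnWith_integral hφ
  refine ⟨C, fun s hs t ht => ?_⟩
  rw [integral_eq hs, integral_eq ht]
  exact hC hs ht

theorem ae_rlDifferentiableAt [CompleteSpace E] (hα : α ∈ Ioo 0 1) (hT : 0 ≤ T)
    (hx : MemRLIntegralLinfty T α x) :
    ∀ᵐ t ∂volume.restrict (Icc 0 T), RLDifferentiableAt T α x t := by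
  obtain ⟨φ, hφ, integral_eq⟩ := hx.exists_rlIntegral_one_sub_eq_integral hα
  have integrable : IntervalIntegrable φ volume 0 T :=
    intervalIntegrable_of_memLp_top hφ (left_mem_Icc.2 hT) (right_mem_Icc.2 hT)
  rw [ae_restrict_iff' measurableSet_Icc]
  filter_upwards [integrable.ae_hasDerivAt_integral] with t hasDerivAt ht
  refine ⟨fun s hs => intervalIntegrable_one_div_sub_rpow_smul_of_continuousOn hα.2 hs.1
    ((hx.continuousOn hα).mono (Icc_subset_Icc_right hs.2)), ?_⟩
  rw [rlKernelIntegral_eq_smul_rlIntegral hα.2]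
  rw [← uIcc_of_le hT] at ht
  have deriv := (hasDerivAt ht 0 left_mem_uIcc).hasDerivWithinAt (s := Icc 0 T)
  rw [uIcc_of_le hT] at ht
  exact (deriv.congr integral_eq (integral_eq ht)).differentiableWithinAt.const_smul _

end MemRLIntegralLinfty

end MemRLIntegralLinfty

section Bregman

variable {E : Type*} [NormedAddCommGroup E] [NormedSpace ℝ E] {V : E → ℝ}

/-- The Bregman divergence `V(v) - V(u) - DV(u)(v - u)` of `V`: the error at `v` of the tangent
approximation of `V` at `u`. -/
noncomputable def bregman (V : E → ℝ) (u v : E) : ℝ :=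
  V v - V u - fderiv ℝ V u (v - u)

theorem bregman_nonneg {u : E} (hV : ConvexOn ℝ univ V) (hVu : DifferentiableAt ℝ V u) (v : E) :
    0 ≤ bregman V u v := by
  have line_zero : AffineMap.lineMap u v (0 : ℝ) = u := AffineMap.lineMap_apply_zero u v
  have deriv : HasDerivAt (V ∘ AffineMap.lineMap u v) (fderiv ℝ V u (v - u)) (0 : ℝ) :=
    HasFDerivAt.comp_hasDerivAt 0 (by rw [line_zero]; exact hVu.hasFDerivAt)
      AffineMap.hasDerivAt_lineMap
  have slope_le := (hV.comp_affineMap (AffineMap.lineMap (k := ℝ) u v)).le_slope_of_hasDerivAt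
    (mem_univ 0) (mem_univ 1) one_pos deriv
  simp only [slope_def_field, Function.comp_apply, AffineMap.lineMap_apply_zero,
    AffineMap.lineMap_apply_one, sub_zero, div_one] at slope_le
  exact sub_nonneg.2 slope_le

theorem abs_bregman_le_of_lipschitzOnWith {s : Set E} {K : ℝ≥0} (hs : Convex ℝ s)
    (hV : ∀ w ∈ s, DifferentiableAt ℝ V w) (hK : LipschitzOnWith K (fderiv ℝ V) s) {u v : E}
    (hu : u ∈ s) (hv : v ∈ s) : |bregman V u v| ≤ K * ‖v - u‖ ^ 2 := by
  have segment_subset : segment ℝ u v ⊆ s := hs.segment_subset hu hv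
  have fderiv_bound : ∀ w ∈ segment ℝ u v, ‖fderiv ℝ V w - fderiv ℝ V u‖ ≤ K * ‖v - u‖ := by
    intro w hw
    refine (hK.norm_sub_le (segment_subset hw) hu).trans ?_
    gcongr
    exact norm_sub_le_of_mem_segment hw
  have mean_value := (convex_segment u v).norm_image_sub_le_of_norm_fderiv_le'
    (fun w hw => hV w (segment_subset hw)) fderiv_bound (left_mem_segment ℝ u v)
    (right_mem_segment ℝ u v)
  rwa [mul_assoc, ← sq] at mean_value

theorem exists_abs_bregman_le_of_isCompact [CompleteSpace E] (hV : Differentiable ℝ V)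
    (hV' : LocallyLipschitz (fderiv ℝ V)) {s : Set E} (hs : IsCompact s) :
    ∃ K : ℝ≥0, ∀ u ∈ s, ∀ v ∈ s, |bregman V u v| ≤ K * ‖v - u‖ ^ 2 := by
  have compact_hull : IsCompact (closure (convexHull ℝ s)) :=
    (totallyBounded_convexHull.2 hs.totallyBounded).closure.isCompact_of_isClosed isClosed_closure
  obtain ⟨K, hK⟩ := hV'.locallyLipschitzOn.exists_lipschitzOnWith_of_compact compact_hull
  have subset_hull : s ⊆ closure (convexHull ℝ s) := (subset_convexHull ℝ s).trans subset_closure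
  exact ⟨K, fun u hu v hv => abs_bregman_le_of_lipschitzOnWith (convex_convexHull ℝ s).closure
    (fun w _ => hV w) hK (subset_hull hu) (subset_hull hv)⟩

end Bregman

section Composition

theorem le_of_hasDerivWithinAt_Ioi_of_sub_le {f g : ℝ → ℝ} {f' g' s C p : ℝ} (hp : 1 < p)
    (hf : HasDerivWithinAt f f' (Ioi s) s) (hg : HasDerivWithinAt g g' (Ioi s) s)
    (h : ∀ᶠ t in 𝓝[>] s, f t - f s ≤ g t - g s + C * (t - s) ^ p) : f' ≤ g' := by
  rw [hasDerivWithinAt_iff_tendsto_slope' self_notMem_Ioi] at hf hg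
  have error_tendsto : Tendsto (fun t => C * (t - s) ^ (p - 1)) (𝓝[>] s) (𝓝 0) := by
    have : Continuous fun t => C * (t - s) ^ (p - 1) :=
      continuous_const.mul ((continuous_id.sub continuous_const).rpow_const fun _ =>
        Or.inr (by linarith))
    simpa [Real.zero_rpow (sub_pos.2 hp).ne'] using (this.tendsto s).mono_left nhdsWithin_le_nhds
  have bound_tendsto := hg.add error_tendsto
  rw [add_zero] at bound_tendsto
  refine le_of_tendsto_of_tendsto hf bound_tendsto ?_
  filter_upwards [h, self_mem_nhdsWithin] with t ht hst
  have hst' : 0 < t - s := sub_pos.2 hst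
  rw [slope_def_field, slope_def_field, div_le_iff₀ hst', add_mul, div_mul_cancel₀ _ hst'.ne',
    mul_assoc, ← Real.rpow_add_one hst'.ne', sub_add_cancel]
  exact ht

variable {E : Type*} [NormedAddCommGroup E] [NormedSpace ℝ E] {V : E → ℝ}
  {x : ℝ → E} {α β T : ℝ}

theorem exists_abs_bregman_comp_le [CompleteSpace E] (hV : Differentiable ℝ V)
    (hV' : LocallyLipschitz (fderiv ℝ V)) {r : ℝ≥0} (hr : 0 < r)
    (hx : ∃ C, HolderOnWith C r x (Icc 0 T)) :
    ∃ C : ℝ≥0, ∀ s ∈ Icc 0 T, ∀ τ ∈ Icc 0 T,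
      |bregman V (x s) (x τ)| ≤ C * |τ - s| ^ (2 * r : ℝ) := by
  obtain ⟨C, hC⟩ := hx
  obtain ⟨K, hK⟩ := exists_abs_bregman_le_of_isCompact hV hV'
    (isCompact_Icc.image_of_continuousOn (hC.continuousOn hr))
  refine ⟨K * C ^ 2, fun s hs τ hτ => ?_⟩
  have holder : ‖x τ - x s‖ ≤ C * |τ - s| ^ (r : ℝ) := by
    simpa only [dist_eq_norm, Real.norm_eq_abs] using hC.dist_le hτ hs
  calc |bregman V (x s) (x τ)| ≤ K * ‖x τ - x s‖ ^ 2 :=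
        hK _ (mem_image_of_mem x hs) _ (mem_image_of_mem x hτ)
    _ ≤ K * (C * |τ - s| ^ (r : ℝ)) ^ 2 := by gcongr
    _ = ↑(K * C ^ 2) * |τ - s| ^ (2 * r : ℝ) := by
        rw [mul_comm (2 : ℝ), Real.rpow_mul (abs_nonneg _), Real.rpow_two]
        push_cast
        ring

theorem memLp_top_bregman_comp {t : ℝ} (hV : Continuous V) (hx : ContinuousOn x (Icc 0 t))
    (u : E) : MemLp (fun τ => bregman V u (x τ)) ⊤ (volume.restrict (Icc 0 t)) := by
  refine memLp_top_of_continuousOn_Icc (ContinuousOn.sub ?_ ?_)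
  · exact (hV.comp_continuousOn hx).sub continuousOn_const
  · exact (fderiv ℝ V u).continuous.comp_continuousOn (hx.sub continuousOn_const)

theorem rlIntegral_comp_eq_fderiv_add_bregman [CompleteSpace E] {t : ℝ} (hV : Continuous V)
    (hβ : 0 < β) (ht : 0 ≤ t) (hx : ContinuousOn x (Icc 0 t)) (u : E) :
    rlIntegral β (fun τ => V (x τ)) t
      = fderiv ℝ V u (rlIntegral β x t) + rlIntegral β (fun τ => bregman V u (x τ)) t
        + t ^ β / Real.Gamma (β + 1) * (V 0 - bregman V u 0) := by
  have memLp_x := memLp_top_of_continuousOn_Icc hx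
  have memLp_fderiv : MemLp (fun τ => fderiv ℝ V u (x τ)) ⊤ (volume.restrict (Icc 0 t)) :=
    memLp_top_of_continuousOn_Icc ((fderiv ℝ V u).continuous.comp_continuousOn hx)
  have memLp_bregman := memLp_top_bregman_comp hV hx u
  have expansion : (fun τ => V (x τ))
      = fun τ => (fderiv ℝ V u (x τ) + bregman V u (x τ)) + (V 0 - bregman V u 0) := by
    ext τ
    simp only [bregman, map_sub, map_zero]
    ring
  have memLp_add : MemLp (fun τ => fderiv ℝ V u (x τ) + bregman V u (x τ)) ⊤
      (volume.restrict (Icc 0 t)) := memLp_fderiv.add memLp_bregman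
  rw [expansion, rlIntegral_add memLp_add (memLp_top_const _) hβ ht,
    rlIntegral_add memLp_fderiv memLp_bregman hβ ht, rlIntegral_clm_comp _ memLp_x hβ ht,
    rlIntegral_const hβ ht, smul_eq_mul]

theorem rlIntegral_comp_sub_rlIntegral_comp [CompleteSpace E] {s t : ℝ} (hV : Continuous V)
    (hβ : 0 < β) (hs : 0 ≤ s) (hst : s ≤ t) (hx : ContinuousOn x (Icc 0 t)) (u : E) :
    rlIntegral β (fun τ => V (x τ)) t - rlIntegral β (fun τ => V (x τ)) s
      = fderiv ℝ V u (rlIntegral β x t - rlIntegral β x s)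
        + (rlIntegral β (fun τ => bregman V u (x τ)) t
          - rlIntegral β (fun τ => bregman V u (x τ)) s)
        + (t ^ β - s ^ β) / Real.Gamma (β + 1) * (V 0 - bregman V u 0) := by
  rw [rlIntegral_comp_eq_fderiv_add_bregman hV hβ (hs.trans hst) hx u,
    rlIntegral_comp_eq_fderiv_add_bregman hV hβ hs (hx.mono (Icc_subset_Icc_right hst)) u, map_sub]
  ring

namespace MemRLIntegralLinfty

theorem exists_abs_bregman_le [CompleteSpace E] (hα : α ∈ Ioo 0 1) (hV : Differentiable ℝ V)
    (hV' : LocallyLipschitz (fderiv ℝ V)) (hx : MemRLIntegralLinfty T α x) :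
    ∃ C : ℝ≥0, ∀ s ∈ Icc 0 T, ∀ τ ∈ Icc 0 T,
      |bregman V (x s) (x τ)| ≤ C * |τ - s| ^ (2 * α) := by
  simpa only [Real.coe_toNNReal _ hα.1.le] using
    exists_abs_bregman_comp_le hV hV' (Real.toNNReal_pos.2 hα.1) (hx.exists_holderOnWith hα)

theorem exists_norm_rlIntegral_bregman_sub_le [CompleteSpace E] (hα : α ∈ Ioo 0 1)
    (hV : Differentiable ℝ V) (hV' : LocallyLipschitz (fderiv ℝ V))
    (hx : MemRLIntegralLinfty T α x) :
    ∃ C : ℝ, ∀ s ∈ Icc 0 T, ∀ t ∈ Icc 0 T, s ≤ t →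
      ‖rlIntegral (1 - α) (fun τ => bregman V (x s) (x τ)) t
        - rlIntegral (1 - α) (fun τ => bregman V (x s) (x τ)) s‖ ≤ C * (t - s) := by
  have hα₀ := hα.1
  have hβ : 0 < 1 - α := sub_pos.2 hα.2
  have := Real.Gamma_pos_of_pos hβ
  obtain ⟨C, hC⟩ := hx.exists_abs_bregman_le hα hV hV'
  refine ⟨C / Real.Gamma (1 - α) * (1 / (1 - α) + 1 / α) * T ^ α, fun s hs t ht hst => ?_⟩
  have memLp_bregman := memLp_top_bregman_comp hV.continuous
    ((hx.continuousOn hα).mono (Icc_subset_Icc_right ht.2)) (x s)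
  have bound := norm_rlIntegral_sub_rlIntegral_le_of_norm_le_rpow memLp_bregman
    ⟨hβ, by linarith⟩ (by linarith) C.coe_nonneg hs.1 hst
    fun τ hτ => hC s hs τ ⟨hτ.1, hτ.2.trans ht.2⟩
  rw [show 1 - α + 2 * α - 1 = α by ring] at bound
  refine bound.trans ?_
  have := ht.1
  have : 0 ≤ t - s := sub_nonneg.2 hst
  gcongr
  exact ht.2

theorem exists_abs_rpow_sub_rpow_mul_bregman_zero_le [CompleteSpace E] (hα : α ∈ Ioo 0 1)
    (hV : Differentiable ℝ V) (hV' : LocallyLipschitz (fderiv ℝ V))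
    (hx : MemRLIntegralLinfty T α x) :
    ∃ C : ℝ, ∀ s ∈ Icc 0 T, ∀ t, s ≤ t →
      |(t ^ (1 - α) - s ^ (1 - α)) * bregman V (x s) 0| ≤ C * (t - s) := by
  have hα₀ := hα.1
  obtain ⟨C, hC⟩ := hx.exists_abs_bregman_le hα hV hV'
  refine ⟨C * T ^ α, fun s hs t hst => ?_⟩
  have hT : 0 ≤ T := hs.1.trans hs.2
  have bregman_zero : |bregman V (x s) 0| ≤ C * s ^ (2 * α) := by
    simpa only [hx.apply_zero hT, abs_sub_comm (0 : ℝ), sub_zero, abs_of_nonneg hs.1] using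
      hC s hs 0 (left_mem_Icc.2 hT)
  have weighted : s ^ (2 * α) * |t ^ (1 - α) - s ^ (1 - α)| ≤ s ^ α * (t - s) := by
    have := rpow_mul_abs_rpow_sub_rpow_le (p := 1 - α) (q := 2 * α)
      (abs_le.2 ⟨by linarith [hα.2], by linarith⟩) (by positivity) hs.1 hst
    rwa [show 1 - α + 2 * α - 1 = α by ring] at this
  calc |(t ^ (1 - α) - s ^ (1 - α)) * bregman V (x s) 0|
      ≤ C * (s ^ (2 * α) * |t ^ (1 - α) - s ^ (1 - α)|) := by
        rw [abs_mul, mul_comm, ← mul_assoc]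
        gcongr
    _ ≤ C * (T ^ α * (t - s)) := by
        have : 0 ≤ t - s := sub_nonneg.2 hst
        have := hs.1
        refine mul_le_mul_of_nonneg_left (weighted.trans ?_) C.coe_nonneg
        gcongr
        exact hs.2
    _ = C * T ^ α * (t - s) := (mul_assoc _ _ _).symm

theorem exists_lipschitzOnWith_rlIntegral_comp [CompleteSpace E] (hα : α ∈ Ioo 0 1)
    (hV : Differentiable ℝ V) (hV' : LocallyLipschitz (fderiv ℝ V)) (hV₀ : V 0 = 0)
    (hx : MemRLIntegralLinfty T α x) :
    ∃ C, LipschitzOnWith C (rlIntegral (1 - α) fun t => V (x t)) (Icc 0 T) := by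
  have hβ : 0 < 1 - α := sub_pos.2 hα.2
  have hΓ : 0 < Real.Gamma (1 - α + 1) := Real.Gamma_pos_of_pos (add_pos hβ one_pos)
  have x_cont := hx.continuousOn hα
  obtain ⟨M, hM⟩ := isCompact_Icc.exists_bound_of_continuousOn
    (hV'.continuous.comp_continuousOn x_cont)
  obtain ⟨K, hK⟩ := hx.exists_lipschitzOnWith_rlIntegral hα
  obtain ⟨A, hA⟩ := hx.exists_norm_rlIntegral_bregman_sub_le hα hV hV'
  obtain ⟨B, hB⟩ := hx.exists_abs_rpow_sub_rpow_mul_bregman_zero_le hα hV hV'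
  refine ⟨(M * K + A + B / Real.Gamma (1 - α + 1)).toNNReal,
    holderOnWith_one.1 (holderOnWith_of_dist_le_of_le fun s hs t ht hst => ?_)⟩
  have hst' : 0 ≤ t - s := sub_nonneg.2 hst
  have linear_bound : ‖fderiv ℝ V (x s) (rlIntegral (1 - α) x t - rlIntegral (1 - α) x s)‖
      ≤ M * K * (t - s) := by
    refine ((fderiv ℝ V (x s)).le_of_opNorm_le_of_le (hM s hs) (hK.norm_sub_le ht hs)).trans_eq ?_
    rw [Real.norm_of_nonneg hst', mul_assoc]
  have constant_bound : ‖(t ^ (1 - α) - s ^ (1 - α)) / Real.Gamma (1 - α + 1)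
      * (V 0 - bregman V (x s) 0)‖ ≤ B / Real.Gamma (1 - α + 1) * (t - s) := by
    rw [hV₀, zero_sub, mul_neg, norm_neg, div_mul_eq_mul_div, norm_div, Real.norm_of_nonneg hΓ.le,
      div_mul_eq_mul_div]
    gcongr
    exact hB s hs t hst
  rw [NNReal.coe_one, Real.rpow_one, dist_eq_norm, rlIntegral_comp_sub_rlIntegral_comp
    hV.continuous hβ hs.1 hst (x_cont.mono (Icc_subset_Icc_right ht.2)) (x s)]
  calc _ ≤ M * K * (t - s) + A * (t - s) + B / Real.Gamma (1 - α + 1) * (t - s) :=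
        norm_add_le_of_le (norm_add_le_of_le linear_bound (hA s hs t ht hst)) constant_bound
    _ = (M * K + A + B / Real.Gamma (1 - α + 1)) * (t - s) := by ring
    _ ≤ _ := by
        gcongr
        exact Real.le_coe_toNNReal _

theorem comp [CompleteSpace E] (hα : α ∈ Ioo 0 1) (hT : 0 < T) (hV : Differentiable ℝ V)
    (hV' : LocallyLipschitz (fderiv ℝ V)) (hV₀ : V 0 = 0) (hx : MemRLIntegralLinfty T α x) :
    MemRLIntegralLinfty T α fun t => V (x t) := by
  obtain ⟨C, hC⟩ := hx.exists_lipschitzOnWith_rlIntegral_comp hα hV hV' hV₀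
  exact memRLIntegralLinfty_of_lipschitzOnWith hα hT
    (hV.continuous.comp_continuousOn (hx.continuousOn hα)) hC

theorem exists_rlIntegral_comp_sub_le [CompleteSpace E] (hα : α ∈ Ioo 0 1)
    (hVconvex : ConvexOn ℝ univ V) (hV : Differentiable ℝ V)
    (hV' : LocallyLipschitz (fderiv ℝ V)) (hV₀ : V 0 = 0) (hx : MemRLIntegralLinfty T α x) :
    ∃ C : ℝ, ∀ s ∈ Icc 0 T, ∀ t ∈ Icc 0 T, s ≤ t →
      rlIntegral (1 - α) (fun τ => V (x τ)) t - rlIntegral (1 - α) (fun τ => V (x τ)) s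
        ≤ fderiv ℝ V (x s) (rlIntegral (1 - α) x t - rlIntegral (1 - α) x s)
          + C * (t - s) ^ (1 + α) := by
  have hα₀ := hα.1
  have hβ : 0 < 1 - α := sub_pos.2 hα.2
  have x_cont := hx.continuousOn hα
  have nonneg := fun s v => bregman_nonneg hVconvex (hV (x s)) v
  obtain ⟨C, hC⟩ := hx.exists_abs_bregman_le hα hV hV'
  refine ⟨C / Real.Gamma (1 - α + 1), fun s hs t ht hst => ?_⟩
  have x_cont' := x_cont.mono (Icc_subset_Icc_right ht.2)
  have bregman_bound := rlIntegral_sub_rlIntegral_le_of_nonneg (γ := 2 * α)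
    (memLp_top_bregman_comp hV.continuous x_cont' (x s)) ⟨hβ, by linarith⟩ (by linarith)
    C.coe_nonneg hs.1 hst (fun τ _ => nonneg s (x τ)) fun τ hτ => by
      simpa only [abs_of_nonneg (sub_nonneg.2 hτ.1)] using
        hC s hs τ ⟨hs.1.trans hτ.1, hτ.2.trans ht.2⟩
  rw [show 1 - α + 2 * α = 1 + α by ring] at bregman_bound
  have constant_nonneg : 0 ≤ (t ^ (1 - α) - s ^ (1 - α)) / Real.Gamma (1 - α + 1)
      * bregman V (x s) 0 :=
    mul_nonneg (div_nonneg (sub_nonneg.2 (Real.rpow_le_rpow hs.1 hst hβ.le))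
      (Real.Gamma_nonneg_of_nonneg (by linarith))) (nonneg s 0)
  rw [rlIntegral_comp_sub_rlIntegral_comp hV.continuous hβ hs.1 hst x_cont' (x s), hV₀, zero_sub,
    mul_neg]
  linarith

theorem rlDeriv_comp_le [CompleteSpace E] {s : ℝ} (hα : α ∈ Ioo 0 1) (hs : s ∈ Ico 0 T)
    (hVconvex : ConvexOn ℝ univ V) (hV : Differentiable ℝ V)
    (hV' : LocallyLipschitz (fderiv ℝ V)) (hV₀ : V 0 = 0) (hx : MemRLIntegralLinfty T α x)
    (hxs : RLDifferentiableAt T α x s) (hys : RLDifferentiableAt T α (fun t => V (x t)) s) :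
    rlDeriv T α (fun t => V (x t)) s ≤ fderiv ℝ V (x s) (rlDeriv T α x s) := by
  obtain ⟨C, hC⟩ := hx.exists_rlIntegral_comp_sub_le hα hVconvex hV hV' hV₀
  have Icc_mem : Icc 0 T ∈ 𝓝[>] s := Icc_mem_nhdsGT_of_mem hs
  have deriv_y := (hys.hasDerivWithinAt hα.2).mono_of_mem_nhdsWithin Icc_mem
  have deriv_x := (hxs.hasDerivWithinAt hα.2).mono_of_mem_nhdsWithin Icc_mem
  refine le_of_hasDerivWithinAt_Ioi_of_sub_le (C := C) (lt_add_of_pos_right 1 hα.1) deriv_y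
    ((fderiv ℝ V (x s)).hasFDerivAt.comp_hasDerivWithinAt s deriv_x) ?_
  filter_upwards [Icc_mem, self_mem_nhdsWithin] with t ht hst
  simpa only [Function.comp_apply, map_sub] using hC s (Ico_subset_Icc_self hs) t ht (le_of_lt hst)

end MemRLIntegralLinfty

end Composition

theorem locallyLipschitz_fderiv_of_gradient {E : Type*} [NormedAddCommGroup E]
    [InnerProductSpace ℝ E] [CompleteSpace E] {V : E → ℝ}
    (hV : ∀ r : ℝ, 0 ≤ r → ∃ L : ℝ, 0 < L ∧
      ∀ u ∈ Metric.closedBall (0 : E) r, ∀ v ∈ Metric.closedBall (0 : E) r,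
        ‖gradient V u - gradient V v‖ ≤ L * ‖u - v‖) :
    LocallyLipschitz (fderiv ℝ V) := by
  intro u
  obtain ⟨L, hL₀, hL⟩ := hV (‖u‖ + 1) (by positivity)
  refine ⟨L.toNNReal, Metric.closedBall 0 (‖u‖ + 1), ?_, ?_⟩
  · exact Metric.closedBall_mem_nhds_of_mem (by simp)
  · refine LipschitzOnWith.of_dist_le_mul fun v hv w hw => ?_
    rw [Real.coe_toNNReal _ hL₀.le, dist_eq_norm, dist_eq_norm, ← toDual_gradient,
      ← toDual_gradient, ← map_sub, LinearIsometryEquiv.norm_map]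
    exact hL v hv w hw

theorem mainTheorem2_general {E : Type*} [NormedAddCommGroup E] [NormedSpace ℝ E] [CompleteSpace E]
    {α T : ℝ} (hα : α ∈ Ioo 0 1) (hT : 0 < T) {V : E → ℝ} (hVconvex : ConvexOn ℝ univ V)
    (hV₀ : V 0 = 0) (hV : Differentiable ℝ V) (hV' : LocallyLipschitz (fderiv ℝ V)) {x : ℝ → E}
    (hx : MemRLIntegralLinfty T α x) :
    MemRLIntegralLinfty T α (fun t => V (x t)) ∧
      ∀ᵐ t ∂(volume.restrict (Icc 0 T)),
        RLDifferentiableAt T α x t ∧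
        RLDifferentiableAt T α (fun s => V (x s)) t ∧
        rlDeriv T α (fun s => V (x s)) t ≤ fderiv ℝ V (x t) (rlDeriv T α x t) := by
  have hy := hx.comp hα hT hV hV' hV₀
  refine ⟨hy, ?_⟩
  filter_upwards [hx.ae_rlDifferentiableAt hα hT.le, hy.ae_rlDifferentiableAt hα hT.le,
    ae_restrict_mem measurableSet_Icc, Measure.ae_ne _ T] with t hxt hyt ht htT
  exact ⟨hxt, hyt,
    hx.rlDeriv_comp_le hα ⟨ht.1, lt_of_le_of_ne ht.2 htT⟩ hVconvex hV hV' hV₀ hxt hyt⟩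

theorem mainTheorem2 (n : ℕ) (α T : ℝ) (hα : α ∈ Ioo (0 : ℝ) 1) (hT : 0 < T)
    (V : EuclideanSpace ℝ (Fin n) → ℝ)
    (hVconvex : ConvexOn ℝ univ V) (hV0 : V 0 = 0)
    (hVdiff : Differentiable ℝ V)
    (hVgrad : ∀ r : ℝ, 0 ≤ r → ∃ L : ℝ, 0 < L ∧
      ∀ u ∈ Metric.closedBall (0 : EuclideanSpace ℝ (Fin n)) r,
        ∀ v ∈ Metric.closedBall (0 : EuclideanSpace ℝ (Fin n)) r,
          ‖gradient V u - gradient V v‖ ≤ L * ‖u - v‖)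
    (x : ℝ → EuclideanSpace ℝ (Fin n)) (hx : MemRLIntegralLinfty T α x) :
    MemRLIntegralLinfty T α (fun t => V (x t)) ∧
      ∀ᵐ t ∂(volume.restrict (Icc 0 T)),
        RLDifferentiableAt T α x t ∧
        RLDifferentiableAt T α (fun s => V (x s)) t ∧
        rlDeriv T α (fun s => V (x s)) t ≤ inner ℝ (gradient V (x t)) (rlDeriv T α x t) := by
  simpa only [← inner_gradient_left] using mainTheorem2_general hα hT hVconvex hV0 hVdiff
    (locallyLipschitz_fderiv_of_gradient hVgrad) hx
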